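/- For a nonzero polynomial $p \in \mathbb{C}[x_1,\dots,x_l]$ with factorization $p = c\,p_1^{e_1}\cdots p_s^{e_s}$, where $c\in\mathbb{C}^*$, all $p_i$ are irreducible and pairwise relatively prime, and all $e_i \ge 1$, let $\mathfrak{r}(p) := p_1 p_2\cdots p_s$ be its square-free part and $r(p) := \deg \mathfrak{r}(p)$. For $e \ge 1$, let $\mathfrak{r}_e(p) := \gcd\{p, \mathfrak{r}(p)^e\}$ and $r_e(p) := \deg \mathfrak{r}_e(p)$. Here $\deg$ denotes the total degree, and gcds are taken up to nonzero constant factors. Theorem. Let $n \ge 3$ and let $f_1, \dots, f_n \in \mathbb{C}[x_1,\dots,x_l]$ be polynomials, not all constant, such that $f_1 + f_2 + \cdots + f_n = 0$. Assume furthermore that for all $s \ge 1$ and all $1 \le i_1 < i_2 < \cdots < i_s \le n$, $$f_{i_1} + f_{i_2} + \cdots + f_{i_s} = 0 \Longrightarrow \gcd\{f_{i_1}, f_{i_2}, \dots, f_{i_s}\} = 1$$ (the case $s=1$ says that no $f_i$ is zero). Let $d$ be the dimension of the $\mathbb{C}$-vector space spanned by $f_1,\dots,f_n$, and let $k$ be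 the number of indices $i$ for which $f_i$ is constant. Then there exists an integer $\rho$ with $2 \le \rho \le d$ such that $$\max_{1 \le m \le n} \deg f_m \le r_{\rho-1}(f_1) + r_{\rho-1}(f_2) + \cdots + r_{\rho-1}(f_n) - \frac{\rho(\rho-1)}{2}$$ and such that, for every integer $d'$ with $d \le d' \le n-k+1$, $$r_{\rho-1}(f_1) + r_{\rho-1}(f_2) + \cdots + r_{\rho-1}(f_n) - \frac{\rho(\rho-1)}{2} \le (d'-1)\left(r(f_1) + r(f_2) + \cdots + r(f_n) - \frac{d'}{2}\right).$$ -/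

import Mathlib

/-- The ring `ℂ[x₁, …, x_l]`. -/
abbrev CPoly (l : ℕ) : Type := MvPolynomial (Fin l) ℂ

/-- Greatest common divisors in the factorial ring `ℂ[x₁, …, x_l]`. In each class of associated
polynomials (i.e. up to a nonzero constant factor) a representative is chosen, with `1` chosen in
the class of the units; the gcds are the chosen representatives. -/
noncomputable instance CPoly.normalizedGCDMonoid (l : ℕ) : NormalizedGCDMonoid (CPoly l) :=
  letI : NormalizationMonoid (CPoly l) :=
    UniqueFactorizationMonoid.strongNormalizationMonoid.toNormalizationMonoid
  UniqueFactorizationMonoid.toNormalizedGCDMonoid (CPoly l)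

namespace CPoly

/-- A polynomial is constant if it is an element of `ℂ`. -/
def IsConstant {l : ℕ} (g : CPoly l) : Prop := ∃ c : ℂ, g = MvPolynomial.C c

/-- The square-free part `𝔯(g)`: the product of the distinct irreducible factors of `g`. -/
noncomputable def rad {l : ℕ} (g : CPoly l) : CPoly l := UniqueFactorizationMonoid.radical g

/-- `r(g) = deg 𝔯(g)`. -/
noncomputable def r {l : ℕ} (g : CPoly l) : ℕ := (rad g).totalDegree

/-- `𝔯_e(g) = gcd(g, 𝔯(g)^e)`. -/
noncomputable def radE {l : ℕ} (e : ℕ) (g : CPoly l) : CPoly l := gcd g (rad g ^ e)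

/-- `r_e(g) = deg 𝔯_e(g)`. -/
noncomputable def rE {l : ℕ} (e : ℕ) (g : CPoly l) : ℕ := (radE e g).totalDegree

end CPoly

/-! Fix a directional derivative `D` that kills no prime factor of any `f i`; "constants" are the
elements of its kernel. They may be nonconstant polynomials, but nonzero ones are prime to all these
primes, so they do not affect multiplicities. Start from T = {m}, where the degree of `f m` is
bounded by its full multiplicities. While the sum over T is nonzero, `exists_minimal_relation`
supplies a disjoint S, independent over the constants, with a nonzero combination of S equal to one
of T. The Wronskian of S is nonzero (`exists_relation_of_wronskian_eq_zero`). Its degree is at most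
the sum of the degrees over S minus |S|(|S|-1)/2, while a prime p divides it at least as often as
the multiplicities over S exceed |S|-1. Comparing the two truncates multiplicities. The relation
also allows one column to be replaced by a combination of T, so that only one member, of least
multiplicity on S ∪ T, is counted in full (`HeightBound.exists_union`). At the end the sum over T
vanishes, so coprimality makes the full count zero and the sum of the r_{ρ-1}(f_i) remains. Here ρ
is the largest |S|, hence at most d. The second inequality follows from r_e ≤ e·r and the growth of
(x-1)(R-x/2) on integers up to R+1. -/

open MvPolynomial in
/-- The derivative in the direction `z`. -/
noncomputable def directionalDeriv {l : ℕ} (z : Fin l → ℂ) : Derivation ℂ (CPoly l) (CPoly l) :=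
  ∑ i, z i • pderiv i

namespace CPoly

variable {l : ℕ}

/-- A derivation that lowers the total degree of every polynomial that it does not annihilate. -/
def LowersDegree (D : Derivation ℂ (CPoly l) (CPoly l)) : Prop :=
  ∀ a, D a ≠ 0 → (D a).totalDegree + 1 ≤ a.totalDegree

open MvPolynomial in
theorem directionalDeriv_apply (z : Fin l → ℂ) (a : CPoly l) :
    directionalDeriv z a = ∑ i, z i • pderiv i a := by
  have h := map_sum (Derivation.coeFnAddMonoidHom (R := ℂ) (A := CPoly l) (M := CPoly l))
    (fun i => z i • pderiv i) Finset.univ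
  exact (congrFun h a).trans (by simp)

open MvPolynomial in
theorem lowersDegree_directionalDeriv (z : Fin l → ℂ) : LowersDegree (directionalDeriv z) := by
  intro a ha
  have key : ∀ m ∈ (directionalDeriv z a).support, (m.sum fun _ e => e) + 1 ≤ a.totalDegree := by
    intro m hm
    rw [mem_support_iff, directionalDeriv_apply, coeff_sum] at hm
    obtain ⟨i, -, hi⟩ := Finset.exists_ne_zero_of_sum_ne_zero hm
    rw [coeff_smul, coeff_pderiv] at hi
    have h1 : m + Finsupp.single i 1 ∈ a.support := by
      rw [mem_support_iff]
      intro h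
      simp [h] at hi
    have h2 := le_totalDegree h1
    rwa [Finsupp.sum_add_index' (by simp) (by simp), Finsupp.sum_single_index rfl] at h2
  obtain ⟨m, hm⟩ := support_nonempty.mpr ha
  have h1 : (directionalDeriv z a).totalDegree ≤ a.totalDegree - 1 :=
    Finset.sup_le fun m hm => by have := key m hm; omega
  have := key m hm
  omega

open MvPolynomial in
theorem exists_pderiv_ne_zero {p : CPoly l} (hp : p.totalDegree ≠ 0) : ∃ i, pderiv i p ≠ 0 := by
  have : ∃ m ∈ p.support, m ≠ 0 := by
    by_contra! h
    refine hp (Nat.le_zero.mp (Finset.sup_le fun m hm => ?_))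
    simp [h m hm]
  obtain ⟨m, hm, hm0⟩ := this
  obtain ⟨i, hi⟩ := Finsupp.ne_iff.mp hm0
  refine ⟨i, fun h => ?_⟩
  have h1 := coeff_pderiv (i := i) p (m - Finsupp.single i 1)
  have hle : Finsupp.single i 1 ≤ m := by
    rw [Finsupp.single_le_iff]
    exact Nat.one_le_iff_ne_zero.mpr hi
  rw [h, coeff_zero, tsub_add_cancel_of_le hle] at h1
  rcases mul_eq_zero.mp h1.symm with h2 | h2
  · exact mem_support_iff.mp hm h2
  · exact Nat.cast_add_one_ne_zero _ h2

open MvPolynomial in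
/-- Finitely many nonconstant polynomials have nonzero derivatives in a common direction. -/
theorem exists_directionalDeriv_ne_zero (P : Finset (CPoly l))
    (hP : ∀ p ∈ P, p.totalDegree ≠ 0) : ∃ z, ∀ p ∈ P, directionalDeriv z p ≠ 0 := by
  classical
  let φ : CPoly l → ((Fin l → ℂ) →ₗ[ℂ] CPoly l) := fun p =>
    ∑ i, (LinearMap.proj i).smulRight (pderiv i p)
  have hφ : ∀ p z, φ p z = directionalDeriv z p := by
    intro p z
    simp [φ, directionalDeriv_apply]
  -- Directions killing a given p form a proper subspace, and finitely many of these cannot cover a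
  -- space over an infinite field.
  have hs : (⊤ : Submodule ℂ (Fin l → ℂ)) ∉ P.image fun p => LinearMap.ker (φ p) := by
    intro h
    obtain ⟨p, hp, hk⟩ := Finset.mem_image.mp h
    obtain ⟨i, hi⟩ := exists_pderiv_ne_zero (hP p hp)
    have h1 : φ p (Pi.single i 1) = 0 := by
      rw [← LinearMap.mem_ker, hk]
      trivial
    rw [hφ, directionalDeriv_apply, Finset.sum_eq_single i] at h1
    · simp at h1
      exact hi h1
    · intro j _ hj
      simp [hj]
    · simp
  have h2 := Subspace.biUnion_ne_univ_of_top_notMem hs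
  obtain ⟨z, hz⟩ := (Set.ne_univ_iff_exists_notMem _).mp h2
  refine ⟨z, fun p hp h => hz ?_⟩
  simp only [Set.mem_iUnion]
  refine ⟨LinearMap.ker (φ p), Finset.mem_image_of_mem _ hp, ?_⟩
  rw [SetLike.mem_coe, LinearMap.mem_ker, hφ, h]

variable {D : Derivation ℂ (CPoly l) (CPoly l)}

theorem LowersDegree.eq_zero_of_dvd (hD : LowersDegree D) {a : CPoly l} (h : a ∣ D a) :
    D a = 0 := by
  by_contra h0
  have h1 := MvPolynomial.totalDegree_le_of_dvd_of_isDomain h h0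
  have h2 := hD a h0
  omega

theorem LowersDegree.iterate (hD : LowersDegree D) (k : ℕ) (a : CPoly l) (h : D^[k] a ≠ 0) :
    (D^[k] a).totalDegree + k ≤ a.totalDegree := by
  induction k with
  | zero => simp
  | succ k ih =>
    rw [Function.iterate_succ_apply'] at h ⊢
    have h1 := hD _ h
    have h2 := ih fun h0 => h (by rw [h0, map_zero])
    omega

/-- If c = p^(n+1) u with p ∤ u, then D c = 0 forces p ∣ (n+1) u D p. This is impossible in
characteristic zero, since p cannot divide the nonzero D p of smaller degree. -/
theorem multiplicity_eq_zero_of_deriv_eq_zero (hD : LowersDegree D) {p : CPoly l} (hp : Prime p)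
    (hDp : D p ≠ 0) {c : CPoly l} (hc : c ≠ 0) (hDc : D c = 0) : multiplicity p c = 0 := by
  by_contra hm
  obtain ⟨n, hn⟩ := Nat.exists_eq_succ_of_ne_zero hm
  obtain ⟨u, hu, hpu⟩ := (FiniteMultiplicity.of_prime_left hp hc).exists_eq_pow_mul_and_not_dvd
  rw [hn] at hu
  rw [hu, Derivation.leibniz, Derivation.leibniz_pow] at hDc
  have h1 : p ^ n * (p * D u + (n + 1 : ℕ) • (u * D p)) = 0 := by
    rw [← hDc]
    simp only [smul_eq_mul, nsmul_eq_mul, Nat.succ_eq_add_one, Nat.add_sub_cancel]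
    ring
  have h2 := (mul_eq_zero.mp h1).resolve_left (pow_ne_zero _ hp.ne_zero)
  have h3 : p ∣ (n + 1 : ℕ) • (u * D p) := by
    rw [← dvd_add_right (dvd_mul_right p (D u)), h2]
    exact dvd_zero p
  rw [nsmul_eq_mul] at h3
  rcases hp.dvd_or_dvd h3 with h4 | h4
  · have h5 : IsUnit ((n + 1 : ℕ) : CPoly l) := by
      rw [← map_natCast (algebraMap ℂ (CPoly l))]
      exact (IsUnit.mk0 _ (Nat.cast_ne_zero.mpr (Nat.succ_ne_zero n))).map _
    exact hp.not_isUnit (isUnit_of_dvd_unit h4 h5)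
  · rcases hp.dvd_or_dvd h4 with h5 | h5
    · exact hpu h5
    · exact hDp (hD.eq_zero_of_dvd h5)

theorem pow_dvd_iterate (p : CPoly l) {v : ℕ} {a : CPoly l} (h : p ^ v ∣ a) (k : ℕ) :
    p ^ (v - k) ∣ D^[k] a := by
  induction k with
  | zero => simpa using h
  | succ k ih =>
    rw [Function.iterate_succ_apply']
    obtain ⟨b, hb⟩ := ih
    rw [hb, Derivation.leibniz, Derivation.leibniz_pow]
    refine dvd_add ?_ ?_
    · exact Dvd.dvd.mul_right (pow_dvd_pow p (by omega)) _
    · simp only [smul_eq_mul, nsmul_eq_mul]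
      refine Dvd.dvd.mul_left (Dvd.dvd.mul_left ?_ _) _
      exact Dvd.dvd.mul_right (pow_dvd_pow p (by omega)) _

theorem iterate_const_mul {c : CPoly l} (hc : D c = 0) (k : ℕ) (a : CPoly l) :
    D^[k] (c * a) = c * D^[k] a := by
  induction k with
  | zero => rfl
  | succ k ih => simp [Function.iterate_succ_apply', ih, Derivation.leibniz, hc]

theorem iterate_sum {ι : Type*} (s : Finset ι) (g : ι → CPoly l) (k : ℕ) :
    D^[k] (∑ i ∈ s, g i) = ∑ i ∈ s, D^[k] (g i) := by
  induction k with
  | zero => rfl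
  | succ k ih => simp [Function.iterate_succ_apply', ih]

end CPoly

/-! ### Wronskians: vanishing, degree, divisibility. -/

namespace CPoly

variable {l : ℕ} {D : Derivation ℂ (CPoly l) (CPoly l)}

/-- The matrix of iterated derivatives of a family of polynomials. -/
noncomputable def wronskianMatrix (D : Derivation ℂ (CPoly l) (CPoly l)) {n : ℕ}
    (g : Fin n → CPoly l) : Matrix (Fin n) (Fin n) (CPoly l) :=
  Matrix.of fun k j => D^[k] (g j)

/-- The Wronskian of a family of polynomials. -/
noncomputable def wronskian (D : Derivation ℂ (CPoly l) (CPoly l)) {n : ℕ}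
    (g : Fin n → CPoly l) : CPoly l :=
  (wronskianMatrix D g).det

/-- A family with vanishing Wronskian is linearly dependent over the constants of `D`. -/
theorem exists_relation_of_wronskian_eq_zero (hD : LowersDegree D) {n : ℕ} (g : Fin n → CPoly l)
    (hW : wronskian D g = 0) :
    ∃ c : Fin n → CPoly l, c ≠ 0 ∧ (∀ j, D (c j) = 0) ∧ ∑ j, c j * g j = 0 := by
  induction n with
  | zero => simp [wronskian, wronskianMatrix] at hW
  | succ n ih =>
    by_cases hW' : wronskian D (fun j : Fin n => g j.castSucc) = 0
    · obtain ⟨c, hc0, hc, hcg⟩ := ih _ hW'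
      refine ⟨Fin.snoc c 0, fun h => hc0 ?_, fun j => ?_, ?_⟩
      · funext j
        simpa using congrFun h j.castSucc
      · refine Fin.lastCases ?_ (fun j => ?_) j
        · simp
        · simpa using hc j
      · simpa [Fin.sum_univ_castSucc] using hcg
    have hinj : ∀ v : Fin n → CPoly l, (∀ k < n, ∑ j, v j * D^[k] (g j.castSucc) = 0) → v = 0 := by
      intro v hv
      by_contra hv0
      refine hW' (Matrix.exists_mulVec_eq_zero_iff.mp ⟨v, hv0, ?_⟩)
      funext k
      simpa [Matrix.mulVec, dotProduct, wronskianMatrix, mul_comm] using hv k k.2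
    obtain ⟨a, ha0, ha⟩ := Matrix.exists_mulVec_eq_zero_iff.mpr hW
    have ha' : ∀ k < n + 1, ∑ j, a j * D^[k] (g j) = 0 := by
      intro k hk
      simpa [Matrix.mulVec, dotProduct, wronskianMatrix, mul_comm] using congrFun ha ⟨k, hk⟩
    -- A primitive kernel vector replaces the usual division by the last coordinate, so no fractions
    -- occur.
    obtain ⟨b, hab, hb⟩ := Finset.extract_gcd a (s := Finset.univ) Finset.univ_nonempty
    have hG : Finset.univ.gcd a ≠ 0 := by
      intro h
      refine ha0 (funext fun j => ?_)
      exact Finset.gcd_eq_zero_iff.mp h j (Finset.mem_univ j)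
    have hb' : ∀ k < n + 1, ∑ j, b j * D^[k] (g j) = 0 := by
      intro k hk
      have h := ha' k hk
      simp_rw [hab _ (Finset.mem_univ _), mul_assoc, ← Finset.mul_sum] at h
      exact (mul_eq_zero.mp h).resolve_left hG
    -- Differentiate row k and subtract row k+1.
    have hDb : ∀ k < n, ∑ j, D (b j) * D^[k] (g j) = 0 := by
      intro k hk
      have h := congrArg D (hb' k (by omega))
      have h2 := hb' (k + 1) (by omega)
      simp only [map_sum, Derivation.leibniz, smul_eq_mul, map_zero, Finset.sum_add_distrib,
        ← Function.iterate_succ_apply' (f := D)] at h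
      rw [h2, zero_add] at h
      rw [← h]
      exact Finset.sum_congr rfl fun j _ => mul_comm _ _
    set t := Fin.last n
    have hcross : ∀ j : Fin n, b t * D (b j.castSucc) - D (b t) * b j.castSucc = 0 := by
      refine congrFun (hinj _ fun k hk => ?_)
      have h1 := hb' k (by omega)
      have h2 := hDb k hk
      rw [Fin.sum_univ_castSucc] at h1 h2
      calc _ = b t * (∑ j : Fin n, D (b j.castSucc) * D^[k] (g j.castSucc)
              + D (b t) * D^[k] (g t))
            - D (b t) * (∑ j : Fin n, b j.castSucc * D^[k] (g j.castSucc)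
              + b t * D^[k] (g t)) := by
            simp only [sub_mul, Finset.sum_sub_distrib, mul_add, Finset.mul_sum, mul_assoc]
            ring
        _ = 0 := by rw [h1, h2]; simp
    have hbt0 : b t ≠ 0 := by
      intro h0
      have h1 : (fun j : Fin n => b j.castSucc) = 0 := by
        refine hinj _ fun k hk => ?_
        have h1 := hb' k (by omega)
        rw [Fin.sum_univ_castSucc] at h1
        simpa [show b (Fin.last n) = 0 from h0] using h1
      refine ha0 (funext fun j => ?_)
      rw [hab j (Finset.mem_univ j)]
      refine Fin.lastCases ?_ (fun j => ?_) j
      · simp [show b (Fin.last n) = 0 from h0]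
      · simp [show b j.castSucc = 0 from congrFun h1 j]
    have hdvd : ∀ j, b t ∣ D (b t) * b j := by
      intro j
      refine Fin.lastCases ?_ (fun j => ?_) j
      · exact dvd_mul_left _ _
      · exact ⟨_, (sub_eq_zero.mp (hcross j)).symm⟩
    -- Uses that b has gcd 1; the drop in degree then forces D (b t) = 0.
    have hdvd2 : b t ∣ D (b t) := by
      have h1 : b t ∣ Finset.univ.gcd fun j => D (b t) * b j :=
        Finset.dvd_gcd fun j _ => hdvd j
      simpa [hb] using h1.trans (Finset.gcd_mul_left' Finset.univ b (D (b t))).dvd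
    have hDt := hD.eq_zero_of_dvd hdvd2
    refine ⟨b, fun h => hbt0 (congrFun h t), fun j => ?_, hb' 0 (by omega)⟩
    refine Fin.lastCases hDt (fun j => ?_) j
    have h1 := hcross j
    rw [hDt, zero_mul, sub_zero] at h1
    exact (mul_eq_zero.mp h1).resolve_left hbt0

/-- Each term of the determinant expansion uses every row once, and row k lowers the degree by at
least k. -/
theorem totalDegree_wronskian_le (hD : LowersDegree D) {n : ℕ} (g : Fin n → CPoly l)
    (hW : wronskian D g ≠ 0) :
    (wronskian D g).totalDegree + ∑ k : Fin n, (k : ℕ) ≤ ∑ j, (g j).totalDegree := by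
  have key : ∀ σ : Equiv.Perm (Fin n),
      ∏ j, wronskianMatrix D g (σ j) j ≠ 0 →
      (∏ j, wronskianMatrix D g (σ j) j).totalDegree + ∑ k : Fin n, (k : ℕ)
        ≤ ∑ j, (g j).totalDegree := by
    intro σ hσ
    have h1 : ∑ k : Fin n, (k : ℕ) = ∑ j, ((σ j : Fin n) : ℕ) :=
      (Equiv.sum_comp σ fun k : Fin n => (k : ℕ)).symm
    have h2 := MvPolynomial.totalDegree_finsetProd Finset.univ
      fun j => wronskianMatrix D g (σ j) j
    have h3 : ∑ j, ((wronskianMatrix D g (σ j) j).totalDegree + ((σ j : Fin n) : ℕ))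
        ≤ ∑ j, (g j).totalDegree :=
      Finset.sum_le_sum fun j _ =>
        hD.iterate _ _ (Finset.prod_ne_zero_iff.mp hσ j (Finset.mem_univ j))
    rw [Finset.sum_add_distrib] at h3
    omega
  have hdet := Matrix.det_apply' (wronskianMatrix D g)
  change wronskian D g = _ at hdet
  obtain ⟨σ₀, -, hσ₀⟩ := Finset.exists_ne_zero_of_sum_ne_zero (hdet ▸ hW)
  have h0 := key σ₀ (right_ne_zero_of_mul hσ₀)
  have h1 : (wronskian D g).totalDegree
      ≤ ∑ j, (g j).totalDegree - ∑ k : Fin n, (k : ℕ) := by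
    rw [hdet]
    refine (MvPolynomial.totalDegree_finsetSum _ _).trans (Finset.sup_le fun σ _ => ?_)
    by_cases hσ : ∏ j, wronskianMatrix D g (σ j) j = 0
    · simp [hσ]
    · have h2 := key σ hσ
      refine (MvPolynomial.totalDegree_mul _ _).trans ?_
      have h3 : (((Equiv.Perm.sign σ : ℤ) : CPoly l)).totalDegree = 0 := by
        rw [← map_intCast (MvPolynomial.C (σ := Fin l) (R := ℂ)), MvPolynomial.totalDegree_C]
      omega
  omega

theorem pow_sum_dvd_wronskian (p : CPoly l) {n : ℕ} (g : Fin n → CPoly l) (v : Fin n → ℕ)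
    (hv : ∀ j, p ^ v j ∣ g j) : p ^ (∑ j, (v j - (n - 1))) ∣ wronskian D g := by
  have h : ∀ k j : Fin n, p ^ (v j - (n - 1)) ∣ wronskianMatrix D g k j := fun k j =>
    (pow_dvd_pow p (by omega)).trans (pow_dvd_iterate p (hv j) k)
  choose B hB using h
  have h2 : wronskianMatrix D g = Matrix.of fun k j => p ^ (v j - (n - 1)) * B k j := by
    ext1 k j
    exact hB k j
  rw [wronskian, h2, ← Finset.prod_pow_eq_pow_sum]
  exact ⟨_, Matrix.det_mul_row (fun j => p ^ (v j - (n - 1))) (Matrix.of B)⟩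

/-- Constants commute with every iterate of D, so this is a column operation. -/
theorem wronskian_update_sum {n : ℕ} (g : Fin n → CPoly l) (c : Fin n → CPoly l)
    (hc : ∀ j, D (c j) = 0) (i : Fin n) :
    wronskian D (Function.update g i (∑ j, c j * g j)) = c i * wronskian D g := by
  rw [wronskian, wronskian, ← smul_eq_mul, ← Matrix.det_updateCol_sum]
  congr 1
  ext1 k j
  by_cases hj : j = i
  · subst hj
    simp [wronskianMatrix, iterate_sum, iterate_const_mul (hc _)]
  · simp [wronskianMatrix, hj]

end CPoly

/-! ### Degrees, multiplicities and truncated radicals. -/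

namespace CPoly

variable {l : ℕ}

open UniqueFactorizationMonoid

theorem totalDegree_pow_of_ne_zero {a : CPoly l} (ha : a ≠ 0) (n : ℕ) :
    (a ^ n).totalDegree = n * a.totalDegree := by
  induction n with
  | zero => simp
  | succ n ih =>
    rw [pow_succ, MvPolynomial.totalDegree_mul_of_isDomain (pow_ne_zero n ha) ha, ih]
    ring

theorem totalDegree_prod_of_ne_zero {ι : Type*} (s : Finset ι) (g : ι → CPoly l)
    (hg : ∀ i ∈ s, g i ≠ 0) : (∏ i ∈ s, g i).totalDegree = ∑ i ∈ s, (g i).totalDegree := by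
  classical
  induction s using Finset.induction_on with
  | empty => simp
  | insert i s hi ih =>
    rw [Finset.prod_insert hi, Finset.sum_insert hi,
      MvPolynomial.totalDegree_mul_of_isDomain (hg i (Finset.mem_insert_self i s))
        (Finset.prod_ne_zero_iff.mpr fun j hj => hg j (Finset.mem_insert_of_mem hj)),
      ih fun j hj => hg j (Finset.mem_insert_of_mem hj)]

theorem totalDegree_prod_pow (P : Finset (CPoly l)) (hP : ∀ p ∈ P, Prime p) (e : CPoly l → ℕ) :
    (∏ p ∈ P, p ^ e p).totalDegree = ∑ p ∈ P, e p * p.totalDegree := by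
  rw [totalDegree_prod_of_ne_zero _ _ fun p hp => pow_ne_zero _ (hP p hp).ne_zero]
  exact Finset.sum_congr rfl fun p hp => totalDegree_pow_of_ne_zero (hP p hp).ne_zero _

theorem prod_pow_dvd {P : Finset (CPoly l)}
    (hrel : (P : Set (CPoly l)).Pairwise IsRelPrime) {e : CPoly l → ℕ} {a : CPoly l}
    (h : ∀ p ∈ P, p ^ e p ∣ a) : ∏ p ∈ P, p ^ e p ∣ a :=
  Finset.prod_dvd_of_isRelPrime (fun _ hp _ hq hpq => (hrel hp hq hpq).pow) h

theorem sum_mul_totalDegree_le {P : Finset (CPoly l)} (hP : ∀ p ∈ P, Prime p)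
    (hrel : (P : Set (CPoly l)).Pairwise IsRelPrime) {e : CPoly l → ℕ} {a : CPoly l}
    (ha : a ≠ 0) (h : ∀ p ∈ P, p ^ e p ∣ a) :
    ∑ p ∈ P, e p * p.totalDegree ≤ a.totalDegree := by
  rw [← totalDegree_prod_pow P hP]
  exact MvPolynomial.totalDegree_le_of_dvd_of_isDomain (prod_pow_dvd hrel h) ha

theorem totalDegree_eq_of_associated {a b : CPoly l} (h : Associated a b) (hb : b ≠ 0) :
    a.totalDegree = b.totalDegree :=
  le_antisymm (MvPolynomial.totalDegree_le_of_dvd_of_isDomain h.dvd hb)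
    (MvPolynomial.totalDegree_le_of_dvd_of_isDomain h.symm.dvd (h.symm.ne_zero_iff.mp hb))

theorem totalDegree_le_sum_multiplicity {P : Finset (CPoly l)} {a : CPoly l} (ha : a ≠ 0)
    (hPa : primeFactors a ⊆ P) :
    a.totalDegree ≤ ∑ p ∈ P, multiplicity p a * p.totalDegree := by
  classical
  have hp : ∀ p ∈ primeFactors a, Prime p := fun p hp =>
    prime_of_normalized_factor p (mem_primeFactors.mp hp)
  have h1 : ∏ p ∈ primeFactors a, p ^ multiplicity p a = (normalizedFactors a).prod := by
    rw [Finset.prod_multiset_count, toFinset_normalizedFactors]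
    refine Finset.prod_congr rfl fun p hp' => ?_
    rw [multiplicity_eq_count_normalizedFactors (hp p hp').irreducible ha,
      normalize_normalized_factor p (mem_primeFactors.mp hp')]
  have h2 := totalDegree_eq_of_associated (prod_normalizedFactors ha) ha
  rw [← h2, ← h1, totalDegree_prod_pow _ hp]
  exact Finset.sum_le_sum_of_subset hPa

theorem radE_ne_zero {a : CPoly l} (ha : a ≠ 0) (e : ℕ) : radE e a ≠ 0 :=
  fun h => ha ((gcd_eq_zero_iff _ _).mp h).1

theorem sum_min_multiplicity_le_rE {P : Finset (CPoly l)} (hP : ∀ p ∈ P, Prime p)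
    (hrel : (P : Set (CPoly l)).Pairwise IsRelPrime) {a : CPoly l} (ha : a ≠ 0) (e : ℕ) :
    ∑ p ∈ P, min (multiplicity p a) e * p.totalDegree ≤ rE e a := by
  refine sum_mul_totalDegree_le hP hrel (radE_ne_zero ha e) fun p hp => dvd_gcd ?_ ?_
  · exact (pow_dvd_pow p (min_le_left _ _)).trans (pow_multiplicity_dvd p a)
  · by_cases hpa : p ∣ a
    · exact (pow_dvd_pow p (min_le_right _ _)).trans
        (pow_dvd_pow_of_dvd ((dvd_radical_iff_of_irreducible (hP p hp).irreducible ha).mpr hpa) e)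
    · simp [multiplicity_eq_zero.mpr hpa]

theorem rE_le_mul_r (a : CPoly l) (e : ℕ) : rE e a ≤ e * r a := by
  rw [r, ← totalDegree_pow_of_ne_zero (a := rad a) radical_ne_zero]
  exact MvPolynomial.totalDegree_le_of_dvd_of_isDomain (gcd_dvd_right _ _)
    (pow_ne_zero _ radical_ne_zero)

theorem isConstant_iff_totalDegree_eq_zero {a : CPoly l} : a.IsConstant ↔ a.totalDegree = 0 := by
  rw [MvPolynomial.totalDegree_eq_zero_iff_eq_C]
  refine ⟨?_, fun h => ⟨_, h⟩⟩
  rintro ⟨c, rfl⟩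
  simp

theorem isUnit_of_totalDegree_eq_zero {a : CPoly l} (ha : a ≠ 0) (h : a.totalDegree = 0) :
    IsUnit a := by
  rw [MvPolynomial.totalDegree_eq_zero_iff_eq_C] at h
  rw [h] at ha ⊢
  exact (IsUnit.mk0 _ fun h0 => ha (by rw [h0, map_zero])).map _

theorem totalDegree_eq_zero_of_isUnit {a : CPoly l} (h : IsUnit a) : a.totalDegree = 0 := by
  simpa using MvPolynomial.totalDegree_le_of_dvd_of_isDomain h.dvd (one_ne_zero' (CPoly l))

theorem r_pos {a : CPoly l} (ha : a ≠ 0) (h : ¬ a.IsConstant) : 1 ≤ r a := by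
  by_contra hr
  have h1 : IsUnit (rad a) := isUnit_of_totalDegree_eq_zero radical_ne_zero (by rw [r] at hr; omega)
  obtain ⟨n, hn⟩ := exists_dvd_radical_self_pow ha
  exact h (isConstant_iff_totalDegree_eq_zero.mpr
    (totalDegree_eq_zero_of_isUnit (isUnit_of_dvd_unit hn (h1.pow n))))

end CPoly

/-! ### Minimal relations and the Wronskian of a subfamily. -/

namespace CPoly

variable {l : ℕ} {D : Derivation ℂ (CPoly l) (CPoly l)}
variable {ι : Type*}

/-- If the sum over `T` of a family of total sum zero does not vanish, then some nonzero
combination over `T` with constant coefficients is a combination, with nonzero constant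
coefficients, of members outside of `T` that are linearly independent over the constants. -/
theorem exists_minimal_relation [Fintype ι] [DecidableEq ι] (f : ι → CPoly l)
    (hsum : ∑ i, f i = 0) (T : Finset ι) (hT : ∑ i ∈ T, f i ≠ 0) :
    ∃ (S : Finset ι) (c b : ι → CPoly l), Disjoint S T ∧ S.Nonempty ∧
      (∀ i, D (c i) = 0) ∧ (∀ i, D (b i) = 0) ∧ (∀ i ∈ S, c i ≠ 0) ∧
      ∑ i ∈ S, c i * f i = ∑ i ∈ T, b i * f i ∧
      ∀ a : ι → CPoly l, (∀ i, D (a i) = 0) → ∑ i ∈ S, a i * f i = 0 → ∀ i ∈ S, a i = 0 := by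
  let Q : Set (Finset ι) := {S | Disjoint S T ∧ ∃ c b : ι → CPoly l,
    (∀ i, D (c i) = 0) ∧ (∀ i, D (b i) = 0) ∧
      ∑ i ∈ S, c i * f i = ∑ i ∈ T, b i * f i ∧ ∑ i ∈ S, c i * f i ≠ 0}
  have hQ : Tᶜ ∈ Q := by
    have h1 : ∑ i ∈ Tᶜ, f i = -∑ i ∈ T, f i := by
      rw [eq_neg_iff_add_eq_zero, add_comm, Finset.sum_add_sum_compl, hsum]
    refine ⟨disjoint_compl_left, 1, -1, by simp, by simp, by simpa using h1, ?_⟩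
    simpa [h1] using hT
  obtain ⟨S, ⟨hST, c, b, hc, hb, hcb, h0⟩, hmin⟩ :=
    WellFounded.has_min (wellFounded_lt : WellFounded (α := Finset ι) (· < ·)) Q ⟨_, hQ⟩
  have herase : ∀ i ∈ S, ∀ (c' b' : ι → CPoly l), (∀ i, D (c' i) = 0) → (∀ i, D (b' i) = 0) →
      ∑ j ∈ S, c' j * f j = ∑ j ∈ T, b' j * f j → ∑ j ∈ S, c' j * f j ≠ 0 → c' i ≠ 0 := by
    intro i hi c' b' hc' hb' hcb' h0' hci
    have h1 : ∑ j ∈ S.erase i, c' j * f j = ∑ j ∈ S, c' j * f j :=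
      Finset.sum_erase S (by simp [hci])
    exact hmin (S.erase i) ⟨hST.mono_left (Finset.erase_subset _ _), c', b', hc', hb',
      h1 ▸ hcb', h1 ▸ h0'⟩ (Finset.erase_ssubset hi)
  refine ⟨S, c, b, hST, Finset.nonempty_of_sum_ne_zero h0, hc, hb,
    fun i hi => herase i hi c b hc hb hcb h0, hcb, fun a ha hsa i hi => ?_⟩
  by_contra hai
  -- Cross-multiplying cancels the coefficient at i but keeps the sum nonzero, against minimality of
  -- S.
  have h1 : ∑ j ∈ S, (a i * c j - c i * a j) * f j = a i * ∑ j ∈ S, c j * f j := by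
    have : c i * ∑ j ∈ S, a j * f j = 0 := by rw [hsa, mul_zero]
    rw [← sub_zero (a i * _), ← this, Finset.mul_sum, Finset.mul_sum, ← Finset.sum_sub_distrib]
    exact Finset.sum_congr rfl fun j _ => by ring
  refine herase i hi (fun j => a i * c j - c i * a j) (fun j => a i * b j) (fun j => ?_)
    (fun j => ?_) ?_ ?_ (by ring)
  · simp [Derivation.leibniz, ha, hc]
  · simp [Derivation.leibniz, ha, hb]
  · rw [h1, hcb, Finset.mul_sum]
    exact Finset.sum_congr rfl fun j _ => by ring
  · rw [h1]
    exact mul_ne_zero hai h0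

theorem card_le_finrank_span [Fintype ι] [DecidableEq ι] (f : ι → CPoly l) (S : Finset ι)
    (hS : ∀ a : ι → CPoly l, (∀ i, D (a i) = 0) → ∑ i ∈ S, a i * f i = 0 → ∀ i ∈ S, a i = 0) :
    S.card ≤ Module.finrank ℂ (Submodule.span ℂ (Set.range f)) := by
  have hli : LinearIndependent ℂ fun i : S => f i := by
    rw [Fintype.linearIndependent_iff]
    intro g hg i
    have h1 := hS (fun i => if h : i ∈ S then algebraMap ℂ (CPoly l) (g ⟨i, h⟩) else 0)
      (fun i => by by_cases h : i ∈ S <;> simp only [h, dite_true, dite_false, map_zero,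
        Derivation.map_algebraMap]) ?_ i i.2
    · simpa using h1
    · rw [← Finset.sum_coe_sort S, ← hg]
      exact Finset.sum_congr rfl fun j _ => by simp [Algebra.smul_def]
  have : Module.Finite ℂ (Submodule.span ℂ (Set.range f)) :=
    FiniteDimensional.span_of_finite ℂ (Set.finite_range f)
  rw [← Fintype.card_coe, ← finrank_span_eq_card hli]
  refine Submodule.finrank_mono (Submodule.span_mono ?_)
  rintro _ ⟨i, rfl⟩
  exact ⟨i, rfl⟩

/-- The Wronskian of the members of a family that are indexed by a finite set. -/
noncomputable def wronskianOn (D : Derivation ℂ (CPoly l) (CPoly l)) (f : ι → CPoly l)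
    (S : Finset ι) : CPoly l :=
  wronskian D fun k : Fin S.card => f (S.equivFin.symm k)

theorem sum_equivFin_symm {M : Type*} [AddCommMonoid M] (S : Finset ι) (F : ι → M) :
    ∑ k, F (S.equivFin.symm k) = ∑ i ∈ S, F i :=
  (Equiv.sum_comp S.equivFin.symm fun i : S => F i).trans (Finset.sum_coe_sort S F)

theorem wronskianOn_ne_zero [DecidableEq ι] (hD : LowersDegree D) (f : ι → CPoly l)
    (S : Finset ι)
    (hS : ∀ a : ι → CPoly l, (∀ i, D (a i) = 0) → ∑ i ∈ S, a i * f i = 0 → ∀ i ∈ S, a i = 0) :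
    wronskianOn D f S ≠ 0 := by
  intro hW
  obtain ⟨c, hc0, hc, hcf⟩ := exists_relation_of_wronskian_eq_zero hD _ hW
  let a : ι → CPoly l := fun i => if h : i ∈ S then c (S.equivFin ⟨i, h⟩) else 0
  have hac : ∀ k, a (S.equivFin.symm k) = c k := fun k => by simp [a]
  have h1 := hS a (fun i => by by_cases h : i ∈ S <;> simp [a, h, hc]) (by
    rw [← sum_equivFin_symm S fun i => a i * f i, ← hcf]
    exact Finset.sum_congr rfl fun k _ => by rw [hac])
  exact hc0 (funext fun k => by rw [← hac, h1 _ (S.equivFin.symm k).2, Pi.zero_apply])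

theorem totalDegree_wronskianOn_le (hD : LowersDegree D) (f : ι → CPoly l) (S : Finset ι)
    (hW : wronskianOn D f S ≠ 0) :
    (wronskianOn D f S).totalDegree + ∑ k ∈ Finset.range S.card, k
      ≤ ∑ i ∈ S, (f i).totalDegree := by
  have h := totalDegree_wronskian_le hD _ hW
  rwa [sum_equivFin_symm S fun i => (f i).totalDegree,
    Fin.sum_univ_eq_sum_range fun k => k] at h

theorem pow_sum_dvd_wronskianOn (p : CPoly l) (f : ι → CPoly l) (S : Finset ι) :
    p ^ (∑ i ∈ S, (multiplicity p (f i) - (S.card - 1))) ∣ wronskianOn D f S := by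
  rw [← sum_equivFin_symm S fun i => multiplicity p (f i) - (S.card - 1)]
  exact pow_sum_dvd_wronskian p _ _ fun k => pow_multiplicity_dvd _ _

/-- Column i₀ is exchanged for the combination of T, divisible by p^γ. This multiplies the Wronskian
by c i₀, which is prime to p. -/
theorem pow_sum_erase_dvd_wronskianOn [DecidableEq ι] (hD : LowersDegree D) {p : CPoly l}
    (hp : Prime p) (hDp : D p ≠ 0) (f : ι → CPoly l) (S T : Finset ι) (c b : ι → CPoly l)
    (hc : ∀ i, D (c i) = 0) (hc0 : ∀ i ∈ S, c i ≠ 0)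
    (hcb : ∑ i ∈ S, c i * f i = ∑ i ∈ T, b i * f i) {γ : ℕ} (hγ : ∀ i ∈ T, p ^ γ ∣ f i)
    {i₀ : ι} (hi₀ : i₀ ∈ S) :
    p ^ (∑ i ∈ S.erase i₀, (multiplicity p (f i) - (S.card - 1)) + (γ - (S.card - 1)))
      ∣ wronskianOn D f S := by
  set k₀ := S.equivFin ⟨i₀, hi₀⟩ with hk₀
  have hk₀' : (S.equivFin.symm k₀ : ι) = i₀ := by simp [hk₀]
  have hdvd : p ^ γ ∣ ∑ i ∈ S, c i * f i := by
    rw [hcb]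
    exact Finset.dvd_sum fun i hi => (hγ i hi).mul_left _
  have h1 := wronskian_update_sum (D := D) (fun k : Fin S.card => f (S.equivFin.symm k))
    (fun k => c (S.equivFin.symm k)) (fun k => hc _) k₀
  rw [sum_equivFin_symm S fun i => c i * f i, hk₀'] at h1
  let v : ι → ℕ := Function.update (fun i => multiplicity p (f i)) i₀ γ
  have h2 := pow_sum_dvd_wronskian (D := D) p _ (fun k => v (S.equivFin.symm k)) (fun k => by
    by_cases hk : k = k₀
    · subst hk
      rw [hk₀', Function.update_self]
      simpa [v] using hdvd
    · have hk' : (S.equivFin.symm k : ι) ≠ i₀ := fun h =>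
        hk (S.equivFin.symm.injective (Subtype.ext (h.trans hk₀'.symm)))
      rw [Function.update_of_ne hk]
      simp [v, hk', pow_multiplicity_dvd] :
    ∀ k, p ^ v (S.equivFin.symm k) ∣ Function.update
      (fun k : Fin S.card => f (S.equivFin.symm k)) k₀ (∑ i ∈ S, c i * f i) k)
  rw [h1, sum_equivFin_symm S fun i => v i - (S.card - 1), ← Finset.sum_erase_add S _ hi₀] at h2
  have h3 : ∑ i ∈ S.erase i₀, (v i - (S.card - 1))
      = ∑ i ∈ S.erase i₀, (multiplicity p (f i) - (S.card - 1)) :=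
    Finset.sum_congr rfl fun i hi => by
      simp [v, Finset.ne_of_mem_erase hi]
  have h4 : v i₀ = γ := by simp [v]
  rw [h3, h4] at h2
  refine hp.pow_dvd_of_dvd_mul_left _ (fun h => ?_) h2
  have h5 := multiplicity_eq_zero_of_deriv_eq_zero hD hp hDp (hc0 i₀ hi₀) (hc i₀)
  exact multiplicity_eq_zero.mp h5 h

/-- The truncated sum of weights over a disjoint union, with a point of least weight left out. -/
theorem exists_argmin_union [DecidableEq ι] (v : ι → ℕ) (S T : Finset ι)
    (hST : Disjoint S T) {φ : ι} (hφ : φ ∈ T) (hφmin : ∀ i ∈ T, v φ ≤ v i) (e ε : ℕ) :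
    ∃ ψ ∈ S ∪ T, (∀ i ∈ S ∪ T, v ψ ≤ v i) ∧ ∃ w,
      (w = ∑ i ∈ S, (v i - ε) ∨ ∃ i₀ ∈ S, w = ∑ i ∈ S.erase i₀, (v i - ε) + (v φ - ε)) ∧
      ∑ i ∈ S, v i + (v φ + ∑ i ∈ T.erase φ, min (v i) e)
        ≤ w + (v ψ + ∑ i ∈ (S ∪ T).erase ψ, min (v i) (max e ε)) := by
  have hsplit : ∀ U : Finset ι, ∑ i ∈ U, v i
      ≤ ∑ i ∈ U, (v i - ε) + ∑ i ∈ U, min (v i) (max e ε) := fun U => by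
    rw [← Finset.sum_add_distrib]
    exact Finset.sum_le_sum fun i _ => by omega
  have hmono : ∀ U : Finset ι, ∑ i ∈ U, min (v i) e ≤ ∑ i ∈ U, min (v i) (max e ε) := fun U =>
    Finset.sum_le_sum fun i _ => by omega
  -- If φ stays least, the plain Wronskian suffices. Otherwise the least point i₀ lies in S, and
  -- column i₀ is traded for φ.
  by_cases h : ∀ i ∈ S, v φ ≤ v i
  · refine ⟨φ, Finset.mem_union_right _ hφ, fun i hi => ?_, _, Or.inl rfl, ?_⟩
    · exact (Finset.mem_union.mp hi).elim (h i) (hφmin i)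
    · have hφS : φ ∉ S := fun h' => Finset.disjoint_left.mp hST h' hφ
      rw [Finset.erase_union_distrib, Finset.erase_eq_of_notMem hφS,
        Finset.sum_union (hST.mono_right (Finset.erase_subset _ _))]
      have h1 := hsplit S
      have h2 := hmono (T.erase φ)
      omega
  · push Not at h
    obtain ⟨i₁, hi₁, hlt⟩ := h
    obtain ⟨i₀, hi₀, hmin⟩ := S.exists_min_image v ⟨i₁, hi₁⟩
    have hi₀φ : v i₀ < v φ := (hmin i₁ hi₁).trans_lt hlt
    refine ⟨i₀, Finset.mem_union_left _ hi₀, fun i hi => ?_, _, Or.inr ⟨i₀, hi₀, rfl⟩, ?_⟩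
    · exact (Finset.mem_union.mp hi).elim (hmin i) fun hi => hi₀φ.le.trans (hφmin i hi)
    · have hi₀T : i₀ ∉ T := Finset.disjoint_left.mp hST hi₀
      rw [Finset.erase_union_distrib, Finset.erase_eq_of_notMem hi₀T,
        Finset.sum_union (hST.mono_left (Finset.erase_subset _ _)),
        ← Finset.sum_erase_add S v hi₀, ← Finset.sum_erase_add T _ hφ]
      have h1 := hsplit (S.erase i₀)
      have h2 := hmono (T.erase φ)
      omega

end CPoly

/-! ### Growing the index set to a vanishing subsum. -/

namespace CPoly

variable {l : ℕ} {D : Derivation ℂ (CPoly l) (CPoly l)} {ι : Type*}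

/-- The degree of `f m` is bounded by the truncated multiplicities at the primes in `P` of the
members of the family indexed by `T`, where at each prime a member of least multiplicity is
counted in full. -/
def HeightBound [DecidableEq ι] (P : Finset (CPoly l)) (f : ι → CPoly l) (m : ι) (T : Finset ι)
    (ρ : ℕ) : Prop :=
  ∃ φ : CPoly l → ι,
    (∀ p ∈ P, φ p ∈ T ∧ ∀ i ∈ T, multiplicity p (f (φ p)) ≤ multiplicity p (f i)) ∧
    (f m).totalDegree + ∑ k ∈ Finset.range ρ, k
      ≤ ∑ p ∈ P, (multiplicity p (f (φ p))
          + ∑ i ∈ T.erase (φ p), min (multiplicity p (f i)) (ρ - 1)) * p.totalDegree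

theorem heightBound_singleton [DecidableEq ι] {P : Finset (CPoly l)} {f : ι → CPoly l} {m : ι}
    (hm : f m ≠ 0) (hPm : UniqueFactorizationMonoid.primeFactors (f m) ⊆ P) :
    HeightBound P f m {m} 1 :=
  ⟨fun _ => m, by simp, by simpa using totalDegree_le_sum_multiplicity hm hPm⟩

theorem HeightBound.exists_union [Fintype ι] [DecidableEq ι] (hD : LowersDegree D)
    {P : Finset (CPoly l)} (hP : ∀ p ∈ P, Prime p)
    (hrel : (P : Set (CPoly l)).Pairwise IsRelPrime) (hDP : ∀ p ∈ P, D p ≠ 0)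
    {f : ι → CPoly l} (hf : ∀ i, f i ≠ 0)
    (hPf : ∀ i, UniqueFactorizationMonoid.primeFactors (f i) ⊆ P) (hsum : ∑ i, f i = 0)
    {m : ι} {T : Finset ι} (hT : ∑ i ∈ T, f i ≠ 0) {ρ : ℕ} (hρ : 1 ≤ ρ)
    (h : HeightBound P f m T ρ) :
    ∃ S : Finset ι, Disjoint S T ∧ S.Nonempty ∧
      S.card ≤ Module.finrank ℂ (Submodule.span ℂ (Set.range f)) ∧
      HeightBound P f m (S ∪ T) (max ρ S.card) := by
  obtain ⟨φ, hφ, hle⟩ := h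
  obtain ⟨S, c, b, hST, hS, hc, hb, hc0, hcb, hind⟩ := exists_minimal_relation (D := D) f hsum T hT
  refine ⟨S, hST, hS, card_le_finrank_span f S hind, ?_⟩
  have hcard := hS.card_pos
  have hW := wronskianOn_ne_zero hD f S hind
  have hmax : max ρ S.card - 1 = max (ρ - 1) (S.card - 1) := by omega
  have key : ∀ p, ∃ (ψ : ι) (w : ℕ), p ∈ P →
      (ψ ∈ S ∪ T ∧ ∀ i ∈ S ∪ T, multiplicity p (f ψ) ≤ multiplicity p (f i)) ∧
      p ^ w ∣ wronskianOn D f S ∧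
      ∑ i ∈ S, multiplicity p (f i) + (multiplicity p (f (φ p))
          + ∑ i ∈ T.erase (φ p), min (multiplicity p (f i)) (ρ - 1))
        ≤ w + (multiplicity p (f ψ)
          + ∑ i ∈ (S ∪ T).erase ψ, min (multiplicity p (f i)) (max ρ S.card - 1)) := by
    intro p
    by_cases hp : p ∈ P
    · obtain ⟨ψ, hψ, hψmin, w, hw, hle⟩ := exists_argmin_union (fun i => multiplicity p (f i)) S T
        hST (hφ p hp).1 (hφ p hp).2 (ρ - 1) (S.card - 1)
      refine ⟨ψ, w, fun _ => ⟨⟨hψ, hψmin⟩, ?_, hmax ▸ hle⟩⟩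
      rcases hw with rfl | ⟨i₀, hi₀, rfl⟩
      · exact pow_sum_dvd_wronskianOn p f S
      · exact pow_sum_erase_dvd_wronskianOn hD (hP p hp) (hDP p hp) f S T c b hc hc0 hcb
          (fun i hi => (pow_dvd_pow p ((hφ p hp).2 i hi)).trans (pow_multiplicity_dvd _ _)) hi₀
    · exact ⟨m, 0, fun h => absurd h hp⟩
  choose ψ w hψ using key
  refine ⟨ψ, fun p hp => (hψ p hp).1, ?_⟩
  have h1 := sum_mul_totalDegree_le hP hrel hW fun p hp => (hψ p hp).2.1
  have h2 := totalDegree_wronskianOn_le hD f S hW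
  have h3 : ∑ i ∈ S, (f i).totalDegree
      ≤ ∑ p ∈ P, (∑ i ∈ S, multiplicity p (f i)) * p.totalDegree := by
    simp_rw [Finset.sum_mul]
    rw [Finset.sum_comm]
    exact Finset.sum_le_sum fun i _ => totalDegree_le_sum_multiplicity (hf i) (hPf i)
  have h4 : ∑ p ∈ P, (∑ i ∈ S, multiplicity p (f i)) * p.totalDegree
        + ∑ p ∈ P, (multiplicity p (f (φ p))
          + ∑ i ∈ T.erase (φ p), min (multiplicity p (f i)) (ρ - 1)) * p.totalDegree
      ≤ ∑ p ∈ P, w p * p.totalDegree + ∑ p ∈ P, (multiplicity p (f (ψ p))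
          + ∑ i ∈ (S ∪ T).erase (ψ p), min (multiplicity p (f i)) (max ρ S.card - 1))
            * p.totalDegree := by
    rw [← Finset.sum_add_distrib, ← Finset.sum_add_distrib]
    refine Finset.sum_le_sum fun p hp => ?_
    rw [← add_mul, ← add_mul]
    exact Nat.mul_le_mul_right _ (hψ p hp).2.2
  -- Both triangular numbers are available; only the larger is kept.
  have h5 : ∑ k ∈ Finset.range (max ρ S.card), k
      ≤ ∑ k ∈ Finset.range ρ, k + ∑ k ∈ Finset.range S.card, k := by
    rcases max_choice ρ S.card with h | h <;> rw [h] <;> omega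
  omega

theorem exists_heightBound [Fintype ι] [DecidableEq ι] (hD : LowersDegree D)
    {P : Finset (CPoly l)} (hP : ∀ p ∈ P, Prime p)
    (hrel : (P : Set (CPoly l)).Pairwise IsRelPrime) (hDP : ∀ p ∈ P, D p ≠ 0)
    {f : ι → CPoly l} (hf : ∀ i, f i ≠ 0)
    (hPf : ∀ i, UniqueFactorizationMonoid.primeFactors (f i) ⊆ P) (hsum : ∑ i, f i = 0) (m : ι) :
    ∃ (T : Finset ι) (ρ : ℕ), T.Nonempty ∧ ∑ i ∈ T, f i = 0 ∧
      (ρ = 1 ∨ ρ ≤ Module.finrank ℂ (Submodule.span ℂ (Set.range f))) ∧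
      HeightBound P f m T ρ := by
  have key : ∀ (N : ℕ) (T : Finset ι) (ρ : ℕ), Tᶜ.card ≤ N → T.Nonempty → 1 ≤ ρ →
      (ρ = 1 ∨ ρ ≤ Module.finrank ℂ (Submodule.span ℂ (Set.range f))) → HeightBound P f m T ρ →
      ∃ (T : Finset ι) (ρ : ℕ), T.Nonempty ∧ ∑ i ∈ T, f i = 0 ∧
        (ρ = 1 ∨ ρ ≤ Module.finrank ℂ (Submodule.span ℂ (Set.range f))) ∧
        HeightBound P f m T ρ := by
    intro N
    induction N with
    | zero =>
      intro T ρ hN hne _ hρd hb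
      have hT : T = Finset.univ :=
        Finset.compl_eq_empty_iff T |>.mp (Finset.card_eq_zero.mp (Nat.le_zero.mp hN))
      exact ⟨T, ρ, hne, hT ▸ hsum, hρd, hb⟩
    | succ N ih =>
      intro T ρ hN hne hρ hρd hb
      by_cases hT : ∑ i ∈ T, f i = 0
      · exact ⟨T, ρ, hne, hT, hρd, hb⟩
      obtain ⟨S, hST, hS, hSd, hb'⟩ := hb.exists_union hD hP hrel hDP hf hPf hsum hT hρ
      refine ih (S ∪ T) (max ρ S.card) ?_ (hS.mono Finset.subset_union_left) (by omega)
        (by have := hS.card_pos; omega) hb'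
      have h1 : (S ∪ T)ᶜ.card < Tᶜ.card := by
        refine Finset.card_lt_card ⟨Finset.compl_subset_compl.mpr Finset.subset_union_right, ?_⟩
        intro h
        obtain ⟨i, hi⟩ := hS
        have := h (Finset.mem_compl.mpr (Finset.disjoint_left.mp hST hi))
        simp [hi] at this
      omega
  exact key _ {m} 1 le_rfl (Finset.singleton_nonempty m) le_rfl (Or.inl rfl)
    (heightBound_singleton (hf m) (hPf m))

/-- Coprimality over T makes the least multiplicity zero at every prime, so the untruncated terms
disappear. -/
theorem HeightBound.totalDegree_add_le_sum_rE [Fintype ι] [DecidableEq ι] {P : Finset (CPoly l)}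
    (hP : ∀ p ∈ P, Prime p) (hrel : (P : Set (CPoly l)).Pairwise IsRelPrime) {f : ι → CPoly l}
    (hf : ∀ i, f i ≠ 0) {m : ι} {T : Finset ι} (hgcd : T.gcd f = 1) {ρ : ℕ}
    (h : HeightBound P f m T ρ) :
    (f m).totalDegree + ∑ k ∈ Finset.range ρ, k ≤ ∑ i, rE (ρ - 1) (f i) := by
  obtain ⟨φ, hφ, hle⟩ := h
  have h0 : ∀ p ∈ P, multiplicity p (f (φ p)) = 0 := by
    intro p hp
    rw [multiplicity_eq_zero]
    intro hdvd
    refine (hP p hp).not_isUnit (isUnit_of_dvd_one (hgcd ▸ Finset.dvd_gcd fun i hi => ?_))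
    by_contra hi'
    have h1 := (hφ p hp).2 i hi
    rw [multiplicity_eq_zero.mpr hi', Nat.le_zero, multiplicity_eq_zero] at h1
    exact h1 hdvd
  refine hle.trans ?_
  calc _ ≤ ∑ p ∈ P, ∑ i, min (multiplicity p (f i)) (ρ - 1) * p.totalDegree := by
        refine Finset.sum_le_sum fun p hp => ?_
        rw [h0 p hp, zero_add, ← Finset.sum_mul]
        exact Nat.mul_le_mul_right _ (Finset.sum_le_sum_of_subset (Finset.subset_univ _))
    _ = ∑ i, ∑ p ∈ P, min (multiplicity p (f i)) (ρ - 1) * p.totalDegree := Finset.sum_comm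
    _ ≤ _ := Finset.sum_le_sum fun i _ => sum_min_multiplicity_le_rE hP hrel (hf i) _

/-- The degree bound for polynomials of sum zero whose vanishing subsums are coprime. -/
theorem exists_totalDegree_add_le_sum_rE [Fintype ι] (f : ι → CPoly l)
    (hsum : ∑ i, f i = 0)
    (hgcd : ∀ S : Finset ι, S.Nonempty → ∑ i ∈ S, f i = 0 → S.gcd f = 1) (m : ι)
    (hm : ¬ (f m).IsConstant) :
    ∃ ρ : ℕ, 2 ≤ ρ ∧ ρ ≤ Module.finrank ℂ (Submodule.span ℂ (Set.range f)) ∧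
      (f m).totalDegree + ∑ k ∈ Finset.range ρ, k ≤ ∑ i, rE (ρ - 1) (f i) := by
  classical
  have hf : ∀ i, f i ≠ 0 := by
    intro i hi
    have h1 := hgcd {i} (Finset.singleton_nonempty i) (by simpa using hi)
    simp [hi] at h1
  set P := UniqueFactorizationMonoid.primeFactors (∏ i, f i) with hPdef
  have hprod : ∏ i, f i ≠ 0 := Finset.prod_ne_zero_iff.mpr fun i _ => hf i
  have hP : ∀ p ∈ P, Prime p := fun p hp =>
    UniqueFactorizationMonoid.prime_of_normalized_factor p
      (UniqueFactorizationMonoid.mem_primeFactors.mp hp)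
  have hrel : (P : Set (CPoly l)).Pairwise IsRelPrime :=
    UniqueFactorizationMonoid.pairwise_primeFactors_isRelPrime
  have hPf : ∀ i, UniqueFactorizationMonoid.primeFactors (f i) ⊆ P := by
    intro i p hp
    rw [UniqueFactorizationMonoid.mem_primeFactors] at hp
    rw [hPdef, UniqueFactorizationMonoid.mem_primeFactors]
    exact Multiset.mem_of_le ((UniqueFactorizationMonoid.dvd_iff_normalizedFactors_le_normalizedFactors
      (hf i) hprod).mp (Finset.dvd_prod_of_mem f (Finset.mem_univ i))) hp
  obtain ⟨z, hz⟩ := exists_directionalDeriv_ne_zero P fun p hp h =>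
    (hP p hp).not_isUnit (isUnit_of_totalDegree_eq_zero (hP p hp).ne_zero h)
  obtain ⟨T, ρ, hT, hT0, hρ, hb⟩ := exists_heightBound (lowersDegree_directionalDeriv z) hP hrel hz
    hf hPf hsum m
  have h1 := hb.totalDegree_add_le_sum_rE hP hrel hf (hgcd T hT hT0)
  have h2 : (f m).totalDegree ≠ 0 := fun h => hm (isConstant_iff_totalDegree_eq_zero.mpr h)
  -- For ρ ≤ 1 the truncation level is 0, which would bound a positive degree by 0.
  have h3 : 2 ≤ ρ := by
    by_contra h3
    have h4 : ∑ i, rE (ρ - 1) (f i) = 0 := by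
      refine Finset.sum_eq_zero fun i _ => ?_
      have := rE_le_mul_r (f i) (ρ - 1)
      rw [show ρ - 1 = 0 by omega] at this ⊢
      omega
    omega
  exact ⟨ρ, h3, by omega, h1⟩

end CPoly

/-! ### Comparison with the square-free degrees, and conclusion. -/

namespace CPoly

variable {l : ℕ}

theorem sub_ncard_isConstant_le_sum_r {n : ℕ} {f : Fin n → CPoly l} (hf : ∀ i, f i ≠ 0) :
    n - {i : Fin n | (f i).IsConstant}.ncard ≤ ∑ i, r (f i) := by
  classical
  have h1 : {i : Fin n | (f i).IsConstant}.ncard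
      = (Finset.univ.filter fun i => (f i).IsConstant).card := by
    rw [← Set.ncard_coe_finset]
    simp
  have h2 := Finset.card_filter_add_card_filter_not (s := (Finset.univ : Finset (Fin n)))
    fun i => (f i).IsConstant
  have h3 : (Finset.univ.filter fun i => ¬ (f i).IsConstant).card ≤ ∑ i, r (f i) := by
    rw [Finset.card_eq_sum_ones]
    refine (Finset.sum_le_sum fun i hi => r_pos (hf i) (Finset.mem_filter.mp hi).2).trans ?_
    exact Finset.sum_le_sum_of_subset (Finset.filter_subset _ _)
  rw [Finset.card_univ, Fintype.card_fin] at h2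
  omega

end CPoly

theorem sub_one_mul_sub_half_mono {ρ d : ℕ} {R : ℝ} (h : ρ ≤ d) (hR : (d : ℝ) - 1 ≤ R) :
    ((ρ : ℝ) - 1) * (R - (ρ : ℝ) / 2) ≤ ((d : ℝ) - 1) * (R - (d : ℝ) / 2) := by
  rcases h.eq_or_lt with rfl | h
  · exact le_rfl
  have h1 : (ρ : ℝ) + 1 ≤ d := by exact_mod_cast h
  -- This product is exactly the difference of the two sides; its second factor is nonnegative
  -- because ρ ≤ d - 1 gives (d+ρ-1)/2 ≤ d - 1 ≤ R.
  have h2 : 0 ≤ ((d : ℝ) - ρ) * (R - ((d : ℝ) + ρ - 1) / 2) :=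
    mul_nonneg (by linarith) (by linarith)
  linarith

theorem mainTheorem1 (l n : ℕ) (hn : 3 ≤ n) (f : Fin n → CPoly l)
    (hconst : ¬ ∀ i, (f i).IsConstant)
    (hsum : ∑ i, f i = 0)
    (hgcd : ∀ S : Finset (Fin n), S.Nonempty → ∑ i ∈ S, f i = 0 → S.gcd f = 1)
    (d k : ℕ)
    (hd : d = Module.finrank ℂ (Submodule.span ℂ (Set.range f)))
    (hk : k = {i : Fin n | (f i).IsConstant}.ncard) :
    ∃ ρ : ℕ, 2 ≤ ρ ∧ ρ ≤ d ∧
      ((Finset.univ.sup fun m => (f m).totalDegree : ℕ) : ℝ)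
        ≤ (∑ i, (CPoly.rE (ρ - 1) (f i) : ℝ)) - (ρ : ℝ) * ((ρ : ℝ) - 1) / 2 ∧
      ∀ d' : ℕ, d ≤ d' → d' ≤ n - k + 1 →
        (∑ i, (CPoly.rE (ρ - 1) (f i) : ℝ)) - (ρ : ℝ) * ((ρ : ℝ) - 1) / 2
          ≤ ((d' : ℝ) - 1) * ((∑ i, (CPoly.r (f i) : ℝ)) - (d' : ℝ) / 2) := by
  have hf : ∀ i, f i ≠ 0 := by
    intro i hi
    have h1 := hgcd {i} (Finset.singleton_nonempty i) (by simpa using hi)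
    simp [hi] at h1
  have hne : (Finset.univ : Finset (Fin n)).Nonempty := ⟨⟨0, by omega⟩, Finset.mem_univ _⟩
  obtain ⟨m, -, hm⟩ := Finset.exists_mem_eq_sup Finset.univ hne fun m => (f m).totalDegree
  have hmc : ¬ (f m).IsConstant := by
    intro h
    rw [CPoly.isConstant_iff_totalDegree_eq_zero] at h
    refine hconst fun i => CPoly.isConstant_iff_totalDegree_eq_zero.mpr ?_
    have := Finset.le_sup (f := fun m => (f m).totalDegree) (Finset.mem_univ i)
    exact Nat.le_zero.mp (this.trans (hm.trans h).le)
  obtain ⟨ρ, hρ, hρd, hle⟩ := CPoly.exists_totalDegree_add_le_sum_rE f hsum hgcd m hmc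
  have htri : ((∑ k ∈ Finset.range ρ, k : ℕ) : ℝ) = (ρ : ℝ) * ((ρ : ℝ) - 1) / 2 := by
    have h := Finset.sum_range_id_mul_two ρ
    have h' : ((∑ k ∈ Finset.range ρ, k : ℕ) : ℝ) * 2 = (ρ : ℝ) * ((ρ : ℝ) - 1) := by
      rw [← Nat.cast_pred (by omega : 0 < ρ)]
      exact_mod_cast h
    linarith
  refine ⟨ρ, hρ, hd ▸ hρd, ?_, fun d' hdd' hd' => ?_⟩
  · rw [hm, ← htri, le_sub_iff_add_le]
    exact_mod_cast hle
  -- Each of the n - k nonconstant members contributes at least 1 to the sum.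
  · have hR : (d' : ℝ) - 1 ≤ ∑ i, (CPoly.r (f i) : ℝ) := by
      have h1 := CPoly.sub_ncard_isConstant_le_sum_r hf
      have h2 : d' ≤ ∑ i, CPoly.r (f i) + 1 := by omega
      rw [sub_le_iff_le_add]
      exact_mod_cast h2
    refine le_trans ?_ (sub_one_mul_sub_half_mono (ρ := ρ) (by omega) hR)
    have h1 : ∑ i, (CPoly.rE (ρ - 1) (f i) : ℝ) ≤ ((ρ : ℝ) - 1) * ∑ i, (CPoly.r (f i) : ℝ) := by
      rw [Finset.mul_sum, ← Nat.cast_pred (by omega : 0 < ρ)]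
      exact Finset.sum_le_sum fun i _ => by exact_mod_cast CPoly.rE_le_mul_r (f i) (ρ - 1)
    linarith
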